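/- For a permutation $\pi$ of $[n]=\{1,\dots,n\}$ let $\mathrm{basc}(\pi)$, $\mathrm{des}(\pi)$ and $\mathrm{suc}(\pi)$ be the numbers of indices $i\in[n-1]$ with $\pi(i+1)\ge\pi(i)+2$ (big ascents), $\pi(i)>\pi(i+1)$ (descents) and $\pi(i+1)=\pi(i)+1$ (successions), respectively, and put $$A_n(x,y,s)=\sum_{\pi\in\mathfrak S_n}x^{\mathrm{basc}(\pi)}y^{\mathrm{des}(\pi)}s^{\mathrm{suc}(\pi)}.$$ Let $B_n$ be the hyperoctahedral group of permutations $\sigma$ of $\{\pm1,\dots,\pm n\}$ with $\sigma(-i)=-\sigma(i)$. For $\sigma\in B_n$ let $\mathrm{exc}(\sigma)$, $\mathrm{aexc}(\sigma)$, $\mathrm{fix}(\sigma)$, $\mathrm{st}(\sigma)$ and $N(\sigma)$ be the numbers of $i\in[n]$ with $\sigma(|\sigma(i)|)>\sigma(i)$, $\sigma(|\sigma(i)|)<\sigma(i)$, $\sigma(i)=i$, $\sigma(i)=-i$ and $\sigma(i)<0$, respectively, let $\mathrm{cyc}(\sigma)$ be the number of cycles of the permutation $i\mapsto|\sigma(i)|$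 of $[n]$, and put $$B_n(x,y,s,t,p,q)=\sum_{\sigma\in B_n}x^{\mathrm{exc}(\sigma)}y^{\mathrm{aexc}(\sigma)}s^{\mathrm{fix}(\sigma)}t^{\mathrm{st}(\sigma)}p^{\mathrm{cyc}(\sigma)}q^{N(\sigma)},$$ so that $B_0(x,y,s,t,p,q)=1$. Then for every integer $n\ge0$, $$2^nA_{n+1}(x,y,s)=\sum_{i=0}^n\binom ni B_i(x,y,s,y,1,1)\,B_{n-i}(x,y,s,y,1,1).$$ -/

import Mathlib

/-! ### Permutations of `[n]`: big ascents, descents, successions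

`Equiv.Perm (Fin n)` is the symmetric group; positions and values are `0, …, n - 1` in place of
`1, …, n`, which changes none of the statistics below. An index `i` counts only if `i + 1` is
a position too. -/

namespace Succession

/-- The number of big ascents: positions `i` with `π (i + 1) ≥ π i + 2`. -/
def basc {n : ℕ} (π : Equiv.Perm (Fin n)) : ℕ :=
  (Finset.univ.filter fun i : Fin n =>
    ∃ h : (i : ℕ) + 1 < n, (π i : ℕ) + 2 ≤ (π ⟨(i : ℕ) + 1, h⟩ : ℕ)).card

/-- The number of descents: positions `i` with `π i > π (i + 1)`. -/
def des {n : ℕ} (π : Equiv.Perm (Fin n)) : ℕ :=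
  (Finset.univ.filter fun i : Fin n =>
    ∃ h : (i : ℕ) + 1 < n, (π ⟨(i : ℕ) + 1, h⟩ : ℕ) < (π i : ℕ)).card

/-- The number of successions: positions `i` with `π (i + 1) = π i + 1`. -/
def suc {n : ℕ} (π : Equiv.Perm (Fin n)) : ℕ :=
  (Finset.univ.filter fun i : Fin n =>
    ∃ h : (i : ℕ) + 1 < n, (π ⟨(i : ℕ) + 1, h⟩ : ℕ) = (π i : ℕ) + 1).card

/-- The polynomial `A_n(x, y, s)`, evaluated at elements of a commutative ring. -/
def polyA {R : Type*} [CommRing R] (n : ℕ) (x y s : R) : R :=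
  ∑ π : Equiv.Perm (Fin n), x ^ basc π * y ^ des π * s ^ suc π

/-! ### Signed permutations -/

/-- The set `±[n] = {-n, …, -1, 1, …, n}` of integers. -/
abbrev PM (n : ℕ) : Type := {z : ℤ // z ∈ (Finset.Icc (-(n : ℤ)) (n : ℤ)).erase 0}

/-- The negation `i ↦ -i` of `±[n]`. -/
def PM.neg {n : ℕ} (i : PM n) : PM n :=
  ⟨-i.1, by
    have h := i.2
    simp only [Finset.mem_erase, Finset.mem_Icc] at h ⊢
    omega⟩

/-- The absolute value `i ↦ |i|` of `±[n]`. -/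
def PM.abs {n : ℕ} (i : PM n) : PM n :=
  ⟨|i.1|, by
    have h := i.2
    simp only [Finset.mem_erase, Finset.mem_Icc] at h ⊢
    rcases abs_cases i.1 with h' | h' <;> omega⟩

/-- The hyperoctahedral group `B_n`: permutations `σ` of `±[n]` with `σ (-i) = -σ i`. -/
abbrev SignedPerm (n : ℕ) : Type :=
  {σ : Equiv.Perm (PM n) // ∀ i : PM n, σ i.neg = (σ i).neg}

/-- The number of excedances: `i ∈ [n]` with `σ |σ i| > σ i`. -/
noncomputable def exc {n : ℕ} (σ : SignedPerm n) : ℕ :=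
  (Finset.univ.filter fun i : PM n => 0 < i.1 ∧ (σ.1 i).1 < (σ.1 (σ.1 i).abs).1).card

/-- The number of anti-excedances: `i ∈ [n]` with `σ |σ i| < σ i`. -/
noncomputable def aexc {n : ℕ} (σ : SignedPerm n) : ℕ :=
  (Finset.univ.filter fun i : PM n => 0 < i.1 ∧ (σ.1 (σ.1 i).abs).1 < (σ.1 i).1).card

/-- The number of fixed points: `i ∈ [n]` with `σ i = i`. -/
noncomputable def fix {n : ℕ} (σ : SignedPerm n) : ℕ :=
  (Finset.univ.filter fun i : PM n => 0 < i.1 ∧ σ.1 i = i).card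

/-- The number of singletons: `i ∈ [n]` with `σ i = -i`. -/
noncomputable def st {n : ℕ} (σ : SignedPerm n) : ℕ :=
  (Finset.univ.filter fun i : PM n => 0 < i.1 ∧ σ.1 i = i.neg).card

/-- The number of negative entries: `i ∈ [n]` with `σ i < 0`. -/
noncomputable def negs {n : ℕ} (σ : SignedPerm n) : ℕ :=
  (Finset.univ.filter fun i : PM n => 0 < i.1 ∧ (σ.1 i).1 < 0).card

/-- The number of cycles of `σ` in its cycle form, that is, the number of cycles (fixed points
included) of the permutation `i ↦ |σ i|` of `[n]`. The cycle through `i` is represented by the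
union of the orbits of `i` and `-i` under `σ`, which is the set of all `j` such that `|j|` lies
on the cycle of `|i|`; cycles are counted as distinct sets of this kind. -/
noncomputable def cyc {n : ℕ} (σ : SignedPerm n) : ℕ :=
  (Finset.univ.image fun i : PM n =>
    Finset.univ.filter fun j : PM n => σ.1.SameCycle i j ∨ σ.1.SameCycle i j.neg).card

/-- The polynomial `B_n(x, y, s, t, p, q)`, evaluated at elements of a commutative ring. -/
noncomputable def polyB {R : Type*} [CommRing R] (n : ℕ) (x y s t p q : R) : R :=
  ∑ σ : SignedPerm n,
    x ^ exc σ * y ^ aexc σ * s ^ fix σ * t ^ st σ * p ^ cyc σ * q ^ negs σ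

end Succession

/-! Let `D` be a derivation with D x = D y = D s = xy. Both families grow by inserting an element of
extreme value, and since every local factor is x, y or s, replacing one factor by xy in all possible
ways is exactly `D`. For words, inserting a new maximum gives A_{n+2} = (s + y) A_{n+1} + D A_{n+1}
(`polyA_add_two`). For signed permutations in cycle form, a new label ±(n+1) either forms a cycle
alone, with weight s or y, or splits an edge; summing over the two signs gives B_{n+1} = (s + y) B_n
+ 2 D B_n (`polyB_succ`). Taking t = y keeps all factors among x, y, s. By the Leibniz rule and
Pascal's rule, the binomial convolution G_n of B with itself satisfies G_{n+1} = 2(s + y) G_n + 2 D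
G_n, which is also the recurrence of 2^n A_{n+1}; both start at 1. -/

namespace Succession

open Finset

variable {P : Type*} [CommRing P]

/-- The Leibniz rule for a product of factors that a derivation maps to the same element. -/
theorem derivation_prod_of_const {ι : Type*} [DecidableEq ι] (D : Derivation ℤ P P) (f : ι → P)
    (c : P) (t : Finset ι) (h : ∀ i ∈ t, D (f i) = c) :
    D (∏ i ∈ t, f i) = ∑ i ∈ t, c * ∏ j ∈ t.erase i, f j := by
  induction t using Finset.induction_on with
  | empty => simp
  | insert a t ha ih =>
    rw [prod_insert ha, D.leibniz, ih fun i hi => h i (mem_insert_of_mem hi),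
      h a (mem_insert_self a t), sum_insert ha, erase_insert ha, smul_eq_mul, smul_eq_mul, mul_sum,
      add_comm, mul_comm]
    congr 1
    refine sum_congr rfl fun i hi => ?_
    rw [erase_insert_of_ne fun e : a = i => ha (e ▸ hi),
      prod_insert fun e => ha (mem_of_mem_erase e)]
    ring

theorem pow_card_filter {ι : Type*} (t : Finset ι) (p : ι → Prop) [DecidablePred p] (x : P) :
    x ^ (t.filter p).card = ∏ i ∈ t, if p i then x else 1 := by
  simp [prod_ite]

/-! ### Words -/

/-- The weight of two adjacent values of a permutation. -/
def adjWeight (x y s : P) (a b : ℕ) : P :=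
  if b < a then y else if b = a + 1 then s else x

/-- The weight of a permutation, as a product over the pairs of adjacent positions. -/
def wordWeight (x y s : P) {n : ℕ} (π : Equiv.Perm (Fin (n + 1))) : P :=
  ∏ i : Fin n, adjWeight x y s (π i.castSucc) (π i.succ)

theorem card_filter_adjacent {n : ℕ} (r : ℕ → ℕ → Prop) [DecidableRel r]
    (π : Equiv.Perm (Fin (n + 1))) :
    (univ.filter fun i : Fin (n + 1) =>
      ∃ h : (i : ℕ) + 1 < n + 1, r (π i) (π ⟨(i : ℕ) + 1, h⟩)).card =
    (univ.filter fun i : Fin n => r (π i.castSucc) (π i.succ)).card := by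
  symm
  refine card_bij (fun i _ => i.castSucc) ?_ (fun _ _ _ _ h => Fin.castSucc_injective _ h) ?_
  · intro i hi
    simp only [mem_filter, mem_univ, true_and] at hi ⊢
    exact ⟨by simp, hi⟩
  · intro i hi
    simp only [mem_filter, mem_univ, true_and] at hi
    obtain ⟨h, hr⟩ := hi
    exact ⟨⟨i, by omega⟩, by simpa using hr, rfl⟩

theorem polyA_succ_eq_sum_wordWeight (n : ℕ) (x y s : P) :
    polyA (n + 1) x y s = ∑ π : Equiv.Perm (Fin (n + 1)), wordWeight x y s π := by
  refine sum_congr rfl fun π _ => ?_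
  rw [basc, des, suc, card_filter_adjacent (fun a b => a + 2 ≤ b),
    card_filter_adjacent (fun a b => b < a), card_filter_adjacent (fun a b => b = a + 1),
    pow_card_filter, pow_card_filter, pow_card_filter, ← prod_mul_distrib, ← prod_mul_distrib,
    wordWeight]
  refine prod_congr rfl fun i _ => ?_
  -- Adjacent values differ, so exactly one of the three statistics counts each position.
  have hne : (π i.castSucc : ℕ) ≠ π i.succ := fun h =>
    (Fin.castSucc_lt_succ (i := i)).ne (π.injective (Fin.ext h))
  unfold adjWeight
  split_ifs <;> first | omega | simp

/-- The permutation whose word is that of `π` with a new largest value put at position `p`. -/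
def insertMax {n : ℕ} (p : Fin (n + 1)) (π : Equiv.Perm (Fin n)) : Equiv.Perm (Fin (n + 1)) :=
  (finSuccEquiv' p).trans ((Equiv.optionCongr π).trans (finSuccEquiv' (Fin.last n)).symm)

@[simp]
theorem insertMax_self {n : ℕ} (p : Fin (n + 1)) (π : Equiv.Perm (Fin n)) :
    insertMax p π p = Fin.last n := by
  simp [insertMax]

@[simp]
theorem insertMax_succAbove {n : ℕ} (p : Fin (n + 1)) (π : Equiv.Perm (Fin n)) (j : Fin n) :
    insertMax p π (p.succAbove j) = (π j).castSucc := by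
  simp [insertMax]

theorem insertMax_bijective (n : ℕ) : Function.Bijective
    fun z : Fin (n + 1) × Equiv.Perm (Fin n) => insertMax z.1 z.2 := by
  rw [Fintype.bijective_iff_injective_and_card]
  constructor
  · rintro ⟨p, π⟩ ⟨p', π'⟩ h
    simp only at h
    have hp : p = p' := by
      apply (insertMax p' π').injective
      rw [insertMax_self, ← h, insertMax_self]
    subst hp
    congr 1
    ext j
    have := congrArg (fun e : Equiv.Perm _ => e (p.succAbove j)) h
    simp only [insertMax_succAbove] at this
    simpa using congrArg Fin.val this
  · simp [Fintype.card_perm, Nat.factorial_succ]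

theorem wordWeight_insertMax_zero (x y s : P) {n : ℕ} (π : Equiv.Perm (Fin (n + 1))) :
    wordWeight x y s (insertMax 0 π) = y * wordWeight x y s π := by
  have h (i : Fin (n + 1)) : insertMax 0 π i.succ = (π i).castSucc := by
    rw [← Fin.succAbove_zero_apply, insertMax_succAbove]
  rw [wordWeight, Fin.prod_univ_succ, wordWeight]
  simp only [Fin.castSucc_zero, insertMax_self, h, ← Fin.succ_castSucc, Fin.val_castSucc]
  congr 1
  rw [adjWeight, if_pos]
  exact (π 0).isLt

theorem wordWeight_insertMax_last (x y s : P) {n : ℕ} (π : Equiv.Perm (Fin (n + 1))) :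
    wordWeight x y s (insertMax (Fin.last _) π) =
      (if π (Fin.last n) = Fin.last n then s else x) * wordWeight x y s π := by
  have h (i : Fin (n + 1)) : insertMax (Fin.last _) π i.castSucc = (π i).castSucc := by
    rw [← Fin.succAbove_last_apply, insertMax_succAbove]
  rw [wordWeight, Fin.prod_univ_castSucc, wordWeight, mul_comm]
  simp only [Fin.succ_last, insertMax_self, h, Fin.succ_castSucc, Fin.val_castSucc]
  congr 1
  have := (π (Fin.last n)).isLt
  simp only [adjWeight, Fin.ext_iff, Fin.val_last]
  split_ifs <;> first | omega | rfl

theorem wordWeight_insertMax_succ_castSucc (x y s : P) {n : ℕ} (π : Equiv.Perm (Fin (n + 1)))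
    (j : Fin n) :
    wordWeight x y s (insertMax j.succ.castSucc π) =
      (if π j.castSucc = Fin.last n then s else x) * y *
        ∏ i ∈ univ.erase j, adjWeight x y s (π i.castSucc) (π i.succ) := by
  have hlt (k : Fin (n + 1)) (hk : k ≤ j.castSucc) :
      insertMax j.succ.castSucc π k.castSucc = (π k).castSucc := by
    rw [← insertMax_succAbove j.succ.castSucc π k, Fin.succAbove_of_castSucc_lt]
    simpa [Fin.lt_def, Nat.lt_succ_iff, Fin.le_def] using hk
  have hge (k : Fin (n + 1)) (hk : j.succ ≤ k) :
      insertMax j.succ.castSucc π k.succ = (π k).castSucc := by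
    rw [← insertMax_succAbove j.succ.castSucc π k, Fin.succAbove_of_le_castSucc]
    simpa [Fin.le_def] using hk
  rw [wordWeight, Fin.prod_univ_succAbove _ j.castSucc,
    ← mul_prod_erase univ _ (mem_univ j), ← mul_assoc]
  congr 1
  · congr 1
    · rw [hlt _ le_rfl, Fin.succ_castSucc, insertMax_self]
      have := (π j.castSucc).isLt
      simp only [adjWeight, Fin.ext_iff, Fin.val_last, Fin.val_castSucc]
      split_ifs <;> first | omega | rfl
    · rw [Fin.succAbove_castSucc_self, insertMax_self, hge _ le_rfl, adjWeight, if_pos]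
      exact (π j.succ).isLt
  · refine prod_congr rfl fun i hi => ?_
    have hij : i ≠ j := ne_of_mem_erase hi
    rcases lt_or_gt_of_ne hij with hl | hg
    · rw [Fin.succAbove_of_castSucc_lt _ _ (by simpa using hl), hlt _ (by simpa using hl.le),
        Fin.succ_castSucc, hlt _ (Fin.succ_le_castSucc_iff.2 hl)]
      rfl
    · rw [Fin.succAbove_of_le_castSucc _ _ (by simpa using hg.le), ← Fin.succ_castSucc i,
        hge _ (Fin.succ_le_castSucc_iff.2 hg), hge _ (by simpa using hg.le)]
      rfl

/-- The front slot contributes a factor y, and an inner slot generally replaces one factor by xy.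
The slot just after the old maximum is special, as it creates a succession: it supplies the summand
with s. -/
theorem sum_wordWeight_insertMax (x y s : P) (D : Derivation ℤ P P) (hx : D x = x * y)
    (hy : D y = x * y) (hs : D s = x * y) {n : ℕ} (π : Equiv.Perm (Fin (n + 1))) :
    ∑ p, wordWeight x y s (insertMax p π) =
      (s + y) * wordWeight x y s π + D (wordWeight x y s π) := by
  have hD : D (wordWeight x y s π) = ∑ j : Fin n,
      x * y * ∏ i ∈ univ.erase j, adjWeight x y s (π i.castSucc) (π i.succ) := by
    refine derivation_prod_of_const D _ _ _ fun i _ => ?_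
    unfold adjWeight
    split_ifs <;> assumption
  rw [Fin.sum_univ_castSucc, Fin.sum_univ_succ, Fin.castSucc_zero, wordWeight_insertMax_zero,
    wordWeight_insertMax_last]
  simp only [wordWeight_insertMax_succ_castSucc]
  rw [hD]
  obtain ⟨k, hk⟩ := π.surjective (Fin.last n)
  induction k using Fin.lastCases with
  | last =>
    rw [if_pos hk]
    have (j : Fin n) : π j.castSucc ≠ Fin.last n := fun h =>
      (Fin.castSucc_lt_last j).ne (π.injective (h.trans hk.symm))
    simp only [if_neg (this _)]
    ring
  | cast k =>
    rw [if_neg fun h => (Fin.castSucc_lt_last k).ne (π.injective (hk.trans h.symm)),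
      ← add_sum_erase univ _ (mem_univ k), ← add_sum_erase univ _ (mem_univ k), if_pos hk]
    -- The old maximum is followed by a descent, so trading that y for sy multiplies the weight by
    -- s. The xy term thereby missing from the derivative is supplied by the last slot, whose factor
    -- is x.
    have hw : wordWeight x y s π =
        y * ∏ i ∈ univ.erase k, adjWeight x y s (π i.castSucc) (π i.succ) := by
      rw [wordWeight, ← mul_prod_erase univ _ (mem_univ k)]
      congr 1
      rw [adjWeight, if_pos]
      have : π k.succ ≠ Fin.last n := fun h =>
        (Fin.castSucc_lt_succ (i := k)).ne (π.injective (hk.trans h.symm))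
      rw [hk]
      exact Fin.val_lt_last this
    have hr : ∑ j ∈ univ.erase k, (if π j.castSucc = Fin.last n then s else x) * y *
        ∏ i ∈ univ.erase j, adjWeight x y s (π i.castSucc) (π i.succ) =
        ∑ j ∈ univ.erase k, x * y *
        ∏ i ∈ univ.erase j, adjWeight x y s (π i.castSucc) (π i.succ) := by
      refine sum_congr rfl fun j hj => ?_
      rw [if_neg fun h => ne_of_mem_erase hj
        (Fin.castSucc_injective _ (π.injective (h.trans hk.symm)))]
    rw [hr, hw]
    ring

theorem polyA_add_two (x y s : P) (D : Derivation ℤ P P) (hx : D x = x * y)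
    (hy : D y = x * y) (hs : D s = x * y) (n : ℕ) :
    polyA (n + 2) x y s = (s + y) * polyA (n + 1) x y s + D (polyA (n + 1) x y s) := by
  rw [polyA_succ_eq_sum_wordWeight, polyA_succ_eq_sum_wordWeight,
    ← (insertMax_bijective (n + 1)).sum_comp, Fintype.sum_prod_type_right, map_sum, mul_sum,
    ← sum_add_distrib]
  exact sum_congr rfl fun π _ => sum_wordWeight_insertMax x y s D hx hy hs π

/-! ### Signed permutations in cycle form -/

/-- The weight of two consecutive labels `a`, `b` of a cycle. -/
def edgeWeight (x y s : P) (a b : ℤ) : P :=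
  if a = b then (if 0 < a then s else y) else if a < b then x else y

/-- The weight of a permutation whose elements carry the labels `c`. -/
def cycleWeight (x y s : P) {n : ℕ} (c : Fin n → ℤ) (π : Equiv.Perm (Fin n)) : P :=
  ∏ j, edgeWeight x y s (c j) (c (π j))

theorem edgeWeight_mul_edgeWeight (x y s : P) {a b m : ℤ} (h : (a < m ∧ b < m) ∨ (m < a ∧ m < b)) :
    edgeWeight x y s m a * edgeWeight x y s b m = x * y := by
  unfold edgeWeight
  split_ifs <;> first | omega | rfl | exact mul_comm _ _

theorem cycleWeight_decomposeFin_zero (x y s : P) {n : ℕ} (c : Fin n → ℤ) (m : ℤ)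
    (π : Equiv.Perm (Fin n)) :
    cycleWeight x y s (Fin.cons m c : Fin (n + 1) → ℤ) (Equiv.Perm.decomposeFin.symm (0, π)) =
      (if 0 < m then s else y) * cycleWeight x y s c π := by
  simp [cycleWeight, Fin.prod_univ_succ, edgeWeight]

/-- The new element is inserted between `i` and `π i`. As `m` is extreme, one of the two new edges
goes up and the other goes down. -/
theorem cycleWeight_decomposeFin_succ (x y s : P) {n : ℕ} (c : Fin n → ℤ) (m : ℤ)
    (hm : (∀ j, c j < m) ∨ ∀ j, m < c j) (π : Equiv.Perm (Fin n)) (i : Fin n) :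
    cycleWeight x y s (Fin.cons m c : Fin (n + 1) → ℤ)
      (Equiv.Perm.decomposeFin.symm ((π i).succ, π)) =
      x * y * ∏ j ∈ univ.erase i, edgeWeight x y s (c j) (c (π j)) := by
  rw [cycleWeight, Fin.prod_univ_succ, ← mul_prod_erase univ _ (mem_univ i), ← mul_assoc]
  congr 1
  · simp only [Equiv.Perm.decomposeFin_symm_apply_zero, Equiv.Perm.decomposeFin_symm_apply_succ,
      Equiv.swap_apply_right, Fin.cons_zero, Fin.cons_succ]
    exact edgeWeight_mul_edgeWeight x y s (hm.imp (fun h => ⟨h _, h _⟩) fun h => ⟨h _, h _⟩)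
  · refine prod_congr rfl fun j hj => ?_
    rw [Equiv.Perm.decomposeFin_symm_apply_succ, Equiv.swap_apply_of_ne_of_ne (Fin.succ_ne_zero _),
      Fin.cons_succ, Fin.cons_succ]
    exact fun h => ne_of_mem_erase hj (π.injective (Fin.succ_injective _ h))

theorem sum_cycleWeight_decomposeFin (x y s : P) (D : Derivation ℤ P P) (hx : D x = x * y)
    (hy : D y = x * y) (hs : D s = x * y) {n : ℕ} (c : Fin n → ℤ) (m : ℤ)
    (hm : (∀ j, c j < m) ∨ ∀ j, m < c j) (π : Equiv.Perm (Fin n)) :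
    ∑ p, cycleWeight x y s (Fin.cons m c : Fin (n + 1) → ℤ)
      (Equiv.Perm.decomposeFin.symm (p, π)) =
      (if 0 < m then s else y) * cycleWeight x y s c π + D (cycleWeight x y s c π) := by
  have hD : D (cycleWeight x y s c π) =
      ∑ i, x * y * ∏ j ∈ univ.erase i, edgeWeight x y s (c j) (c (π j)) := by
    refine derivation_prod_of_const D _ _ _ fun i _ => ?_
    unfold edgeWeight
    split_ifs <;> assumption
  -- Nonzero images of 0 are indexed by the edge `i → π i` that they split.
  rw [Fin.sum_univ_succ, cycleWeight_decomposeFin_zero, hD, ← Equiv.sum_comp π]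
  simp only [cycleWeight_decomposeFin_succ x y s c m hm]

/-- The labels `±(n - j)` with signs given by `δ`. -/
def label (n : ℕ) (δ : Fin n → Bool) (j : Fin n) : ℤ :=
  (if δ j then 1 else -1) * ((n : ℤ) - j)

/-- Labels decrease in absolute value along the index, so the element adjoined at index 0 gets the
extreme label and the others keep theirs. -/
theorem label_cons (n : ℕ) (b : Bool) (δ : Fin n → Bool) :
    label (n + 1) (Fin.cons b δ) =
      Fin.cons ((if b then 1 else -1) * ((n : ℤ) + 1)) (label n δ) := by
  ext j
  induction j using Fin.cases with
  | zero => simp [label]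
  | succ j => simp [label]

theorem sum_cycleWeight_label_succ (x y s : P) (D : Derivation ℤ P P) (hx : D x = x * y)
    (hy : D y = x * y) (hs : D s = x * y) (n : ℕ) :
    ∑ δ, ∑ π, cycleWeight x y s (label (n + 1) δ) π =
      (s + y) * (∑ δ, ∑ π, cycleWeight x y s (label n δ) π) +
        2 * D (∑ δ, ∑ π, cycleWeight x y s (label n δ) π) := by
  have key (δ : Fin n → Bool) (b : Bool) :
      ∑ π, cycleWeight x y s (label (n + 1) (Fin.cons b δ)) π =
        (if b then s else y) * (∑ π, cycleWeight x y s (label n δ) π) +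
          D (∑ π, cycleWeight x y s (label n δ) π) := by
    rw [label_cons, ← Equiv.Perm.decomposeFin.symm.sum_comp, Fintype.sum_prod_type_right,
      mul_sum, map_sum, ← sum_add_distrib]
    refine sum_congr rfl fun π _ => ?_
    rw [sum_cycleWeight_decomposeFin x y s D hx hy hs]
    · cases b
      · have : ¬ (0 : ℤ) < -1 * ((n : ℤ) + 1) := by omega
        simp only [Bool.false_eq_true, if_false, if_neg this]
      · have : (0 : ℤ) < (n : ℤ) + 1 := by omega
        simp [this]
    · cases b
      · refine Or.inr fun j => ?_
        have := j.isLt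
        cases h : δ j <;> simp [label, h] <;> omega
      · refine Or.inl fun j => ?_
        have := j.isLt
        cases h : δ j <;> simp [label, h] <;> omega
  rw [← (Fin.consEquiv fun _ : Fin (n + 1) => Bool).sum_comp, Fintype.sum_prod_type_right]
  rw [map_sum, mul_sum, mul_sum, ← sum_add_distrib]
  refine sum_congr rfl fun δ _ => ?_
  rw [Fintype.sum_bool]
  refine (congrArg₂ (· + ·) (key δ true) (key δ false)).trans ?_
  simp only [if_true, Bool.false_eq_true, if_false]
  ring

/-! ### Signed permutations as permutations with signs -/

/-- The element of `±[n]` with absolute value `n - j` and sign `b`. -/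
def pm (n : ℕ) (z : Fin n × Bool) : PM n :=
  ⟨(if z.2 then 1 else -1) * ((n : ℤ) - z.1), by
    have := z.1.isLt
    cases h : z.2 <;> simp <;> omega⟩

theorem pm_bijective (n : ℕ) : Function.Bijective (pm n) := by
  constructor
  · rintro ⟨i, a⟩ ⟨j, b⟩ h
    have hv := congrArg Subtype.val h
    have hi := i.isLt
    have hj := j.isLt
    cases a <;> cases b <;> simp [pm] at hv ⊢ <;> omega
  · rintro ⟨z, hz⟩
    simp only [mem_erase, mem_Icc] at hz
    rcases lt_or_gt_of_ne hz.1 with h | h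
    · refine ⟨(⟨(n + z).toNat, by omega⟩, false), Subtype.ext ?_⟩
      simp [pm]
      omega
    · refine ⟨(⟨(n - z).toNat, by omega⟩, true), Subtype.ext ?_⟩
      simp [pm]
      omega

theorem neg_pm (n : ℕ) (j : Fin n) (b : Bool) : (pm n (j, b)).neg = pm n (j, !b) := by
  apply Subtype.ext
  cases b <;> simp [pm, PM.neg]

theorem abs_pm (n : ℕ) (j : Fin n) (b : Bool) : (pm n (j, b)).abs = pm n (j, true) := by
  apply Subtype.ext
  have : (0 : ℤ) ≤ n - j := by omega
  cases b
  · simp only [pm, PM.abs]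
    simp [abs_sub_comm, abs_of_nonneg this]
  · simp [pm, PM.abs, abs_of_nonneg this]

theorem pm_true_pos {n : ℕ} (j : Fin n) : 0 < (pm n (j, true)).1 := by
  simp [pm]

theorem exists_pm_true {n : ℕ} (i : PM n) (h : 0 < i.1) : ∃ j, pm n (j, true) = i := by
  obtain ⟨⟨j, b⟩, rfl⟩ := (pm_bijective n).2 i
  cases b
  · have := j.isLt
    simp [pm] at h
    omega
  · exact ⟨j, rfl⟩

theorem pm_apply_val (n : ℕ) (δ : Fin n → Bool) (j : Fin n) :
    (pm n (j, δ j)).1 = label n δ j := rfl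

/-- The permutation of `Fin n × Bool` that acts by `π` and changes signs according to `δ`. -/
def signPerm {n : ℕ} (π : Equiv.Perm (Fin n)) (δ : Fin n → Bool) : Equiv.Perm (Fin n × Bool) where
  toFun z := (π z.1, z.2 == δ (π z.1))
  invFun z := (π.symm z.1, z.2 == δ z.1)
  left_inv z := by
    rcases z with ⟨i, b⟩
    cases b <;> cases h : δ (π i) <;> simp [h]
  right_inv z := by
    rcases z with ⟨i, b⟩
    cases b <;> cases h : δ i <;> simp [h]

/-- The signed permutation that maps the element with absolute value `n - i` to the element with
absolute value `n - π i` and sign `δ (π i)`. -/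
noncomputable def toSignedPerm {n : ℕ} (z : Equiv.Perm (Fin n) × (Fin n → Bool)) : SignedPerm n :=
  ⟨(Equiv.ofBijective _ (pm_bijective n)).permCongr (signPerm z.1 z.2), fun i => by
    obtain ⟨⟨j, b⟩, rfl⟩ := (pm_bijective n).2 i
    rw [neg_pm]
    simp only [Equiv.permCongr_apply, Equiv.ofBijective_symm_apply_apply, Equiv.ofBijective_apply,
      signPerm, Equiv.coe_fn_mk, neg_pm]
    cases b <;> cases z.2 (z.1 j) <;> rfl⟩

theorem toSignedPerm_pm {n : ℕ} (π : Equiv.Perm (Fin n)) (δ : Fin n → Bool) (i : Fin n) (b : Bool) :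
    (toSignedPerm (π, δ)).1 (pm n (i, b)) = pm n (π i, b == δ (π i)) := by
  simp [toSignedPerm, Equiv.permCongr_apply, signPerm, Equiv.ofBijective_symm_apply_apply]

theorem toSignedPerm_bijective (n : ℕ) :
    Function.Bijective (toSignedPerm : Equiv.Perm (Fin n) × (Fin n → Bool) → SignedPerm n) := by
  constructor
  · rintro ⟨π, δ⟩ ⟨π', δ'⟩ h
    have hp (i : Fin n) : π i = π' i ∧ δ (π i) = δ' (π' i) := by
      have := toSignedPerm_pm π δ i true
      rw [h, toSignedPerm_pm] at this
      simpa [eq_comm] using (pm_bijective n).1 this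
    have hπ : π = π' := Equiv.ext fun i => (hp i).1
    subst hπ
    congr 1
    ext j
    simpa using (hp (π.symm j)).2
  · intro σ
    have hex (i : Fin n) : ∃ z : Fin n × Bool, pm n z = σ.1 (pm n (i, true)) :=
      (pm_bijective n).2 _
    choose f hf using hex
    have hneg (i : Fin n) : σ.1 (pm n (i, false)) = pm n ((f i).1, !(f i).2) := by
      rw [← neg_pm, Prod.mk.eta, hf, ← σ.2, neg_pm]
      rfl
    have hinj : Function.Injective fun i => (f i).1 := by
      intro i j hij
      simp only at hij
      -- Equal absolute values of the images force i = ±j, hence equal indices whichever sign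
      -- occurs.
      by_cases hs : (f i).2 = (f j).2
      · have h : σ.1 (pm n (i, true)) = σ.1 (pm n (j, true)) := by
          rw [← hf, ← hf, Prod.ext hij hs]
        exact congrArg Prod.fst ((pm_bijective n).1 (σ.1.injective h))
      · have h : σ.1 (pm n (i, true)) = σ.1 (pm n (j, false)) := by
          rw [← hf, hneg]
          congr 1
          refine Prod.ext hij ?_
          simpa using Bool.eq_not.2 hs
        exact congrArg Prod.fst ((pm_bijective n).1 (σ.1.injective h))
    let π : Equiv.Perm (Fin n) := Equiv.ofBijective _ (Finite.injective_iff_bijective.1 hinj)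
    have hπ (i : Fin n) : π i = (f i).1 := rfl
    refine ⟨(π, fun j => (f (π.symm j)).2), Subtype.ext (Equiv.ext fun z => ?_)⟩
    obtain ⟨⟨i, b⟩, rfl⟩ := (pm_bijective n).2 z
    rw [toSignedPerm_pm, Equiv.symm_apply_apply, hπ]
    cases b
    · rw [hneg]
      cases (f i).2 <;> rfl
    · rw [← hf]
      simp

theorem card_filter_pos {n : ℕ} (r : PM n → Prop) [DecidablePred r] :
    (univ.filter fun i : PM n => 0 < i.1 ∧ r i).card =
      (univ.filter fun j : Fin n => r (pm n (j, true))).card := by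
  symm
  refine card_bij (fun j _ => pm n (j, true)) ?_ ?_ ?_
  · intro j hj
    simpa [pm_true_pos] using hj
  · intro i _ j _ h
    exact congrArg Prod.fst ((pm_bijective n).1 h)
  · intro i hi
    simp only [mem_filter, mem_univ, true_and] at hi
    obtain ⟨j, rfl⟩ := exists_pm_true i hi.1
    exact ⟨j, by simpa using hi.2, rfl⟩

/-- The sign `δ` belongs to the value, so the entries σ(i) and σ(|σ(i)|) are the labels of `π i` and
`π (π i)`, two consecutive labels of a cycle. Reindexing by `π` matches the factors. -/
theorem polyB_eq_sum_cycleWeight (n : ℕ) (x y s : P) :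
    polyB n x y s y 1 1 = ∑ δ, ∑ π, cycleWeight x y s (label n δ) π := by
  rw [polyB, ← (toSignedPerm_bijective n).sum_comp, Fintype.sum_prod_type_right]
  refine sum_congr rfl fun δ _ => sum_congr rfl fun π _ => ?_
  rw [one_pow, one_pow, mul_one, mul_one, cycleWeight, ← Equiv.prod_comp π, exc, aexc, fix, st,
    card_filter_pos, card_filter_pos, card_filter_pos, card_filter_pos]
  simp only [pow_card_filter]
  rw [← prod_mul_distrib, ← prod_mul_distrib, ← prod_mul_distrib]
  refine prod_congr rfl fun i _ => ?_
  simp only [toSignedPerm_pm, neg_pm, abs_pm, Bool.true_beq, pm_apply_val,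
    (pm_bijective n).1.eq_iff, Prod.mk.injEq]
  have hfix : label n δ (π i) = label n δ (π (π i)) ↔ π i = i := by
    rw [← pm_apply_val, ← pm_apply_val, ← Subtype.ext_iff, (pm_bijective n).1.eq_iff]
    exact ⟨fun h => (π.injective (congrArg Prod.fst h)).symm, fun h => by rw [h, h]⟩
  have hpos : 0 < label n δ (π i) ↔ δ (π i) = true := by
    have := (π i).isLt
    cases h : δ (π i) <;> simp [label, h]
  simp only [edgeWeight, hfix, hpos]
  by_cases h : π i = i
  · simp only [h]
    cases δ i <;> simp
  · have hne := fun e => h (hfix.1 e)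
    rcases lt_or_gt_of_ne hne with hl | hl
    · simp [h, hl, hl.not_gt]
    · simp [h, hl, hl.not_gt]

theorem polyB_succ (x y s : P) (D : Derivation ℤ P P) (hx : D x = x * y)
    (hy : D y = x * y) (hs : D s = x * y) (n : ℕ) :
    polyB (n + 1) x y s y 1 1 = (s + y) * polyB n x y s y 1 1 + 2 * D (polyB n x y s y 1 1) := by
  rw [polyB_eq_sum_cycleWeight, polyB_eq_sum_cycleWeight,
    sum_cycleWeight_label_succ x y s D hx hy hs]

theorem polyB_zero (x y s : P) : polyB 0 x y s y 1 1 = 1 := by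
  simp [polyB_eq_sum_cycleWeight, cycleWeight]

theorem polyA_one (x y s : P) : polyA 1 x y s = 1 := by
  simp [polyA_succ_eq_sum_wordWeight, wordWeight]

/-! ### The convolution identity -/

theorem two_pow_mul_polyA_of_derivation (x y s : P) (D : Derivation ℤ P P) (hx : D x = x * y)
    (hy : D y = x * y) (hs : D s = x * y) (n : ℕ) :
    (2 : P) ^ n * polyA (n + 1) x y s = ∑ ij ∈ antidiagonal n, (n.choose ij.1 : P) *
      (polyB ij.1 x y s y 1 1 * polyB ij.2 x y s y 1 1) := by
  induction n with
  | zero => simp [polyA_one, polyB_zero]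
  | succ n ih =>
    -- Powers of 2 are integer scalars, and `D` is ℤ-linear.
    have h2 (k : ℕ) (a : P) : D ((2 : P) ^ k * a) = 2 ^ k * D a := by
      have := D.map_smul ((2 : ℤ) ^ k) a
      simpa using this
    have hD := congrArg D ih
    rw [h2, map_sum] at hD
    calc (2 : P) ^ (n + 1) * polyA (n + 2) x y s
        = 2 * (s + y) * (2 ^ n * polyA (n + 1) x y s) +
            2 * (2 ^ n * D (polyA (n + 1) x y s)) := by
          rw [polyA_add_two x y s D hx hy hs]; ring
      _ = _ := by
          rw [ih, hD, sum_antidiagonal_choose_succ_mul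
            fun i j => polyB i x y s y 1 1 * polyB j x y s y 1 1, mul_sum, mul_sum,
            ← sum_add_distrib, ← sum_add_distrib]
          refine sum_congr rfl fun ij hij => ?_
          -- Pascal's rule leaves complementary binomials on the two sums; symmetry lets them
          -- combine termwise.
          have hc : (n.choose ij.2 : P) = n.choose ij.1 := by
            rw [← mem_antidiagonal.1 hij, Nat.choose_symm_add]
          rw [hc, D.leibniz, D.leibniz, D.map_natCast, polyB_succ x y s D hx hy hs,
            polyB_succ x y s D hx hy hs]
          simp only [smul_eq_mul]
          ring

theorem map_polyA {Q : Type*} [CommRing Q] (f : P →+* Q) (n : ℕ) (x y s : P) :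
    f (polyA n x y s) = polyA n (f x) (f y) (f s) := by
  simp [polyA]

theorem map_polyB {Q : Type*} [CommRing Q] (f : P →+* Q) (n : ℕ) (x y s t p q : P) :
    f (polyB n x y s t p q) = polyB n (f x) (f y) (f s) (f t) (f p) (f q) := by
  simp [polyB]

end Succession

theorem mainTheorem9 {R : Type*} [CommRing R] (x y s : R) (n : ℕ) :
    (2 : R) ^ n * Succession.polyA (n + 1) x y s =
      ∑ i ∈ Finset.range (n + 1), (n.choose i : R) *
        Succession.polyB i x y s y 1 1 * Succession.polyB (n - i) x y s y 1 1 := by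
  open Succession MvPolynomial in
  -- `R` need not carry such a derivation, so the identity is proved in ℤ[x, y, s], where one
  -- exists, and then specialised.
  let D : Derivation ℤ (MvPolynomial (Fin 3) ℤ) (MvPolynomial (Fin 3) ℤ) :=
    mkDerivation ℤ fun _ => X 0 * X 1
  have hD (i : Fin 3) : D (X i) = X 0 * X 1 := mkDerivation_X ℤ _ i
  have h := congrArg (aeval ![x, y, s] : MvPolynomial (Fin 3) ℤ →ₐ[ℤ] R).toRingHom
    (two_pow_mul_polyA_of_derivation (X 0) (X 1) (X 2) D (hD 0) (hD 1) (hD 2) n)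
  simp only [map_mul, map_sum, map_pow, map_polyA, map_polyB, map_natCast, map_one,
    map_ofNat] at h
  simpa [Finset.Nat.sum_antidiagonal_eq_sum_range_succ_mk, mul_assoc] using h
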